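/- Let $k$ be an algebraically closed field (of any characteristic), and let $\tilde f(t_2,t_2')\in k[t_2,t_2']$ and $\tilde g(t_1,t_1')\in k[t_1,t_1']$ be polynomials that are not both zero. Let $t\ge 0$ be an integer such that the polynomial \[(t_2-t_2')^2\tilde f(t_2,t_2')-(t_1-t_1')^2\tilde g(t_1,t_1')\in k[t_1,t_1',t_2,t_2']\] has at most $t$ distinct irreducible factors (up to multiplication by units). Consider the variety (closed subscheme) \[X=V\bigl(s(t_1-t_1')+(t_2-t_2')\tilde f(t_2,t_2'),\; s(t_2-t_2')+(t_1-t_1')\tilde g(t_1,t_1')\bigr)\subset\mathbb{A}^5_k\] with coordinates $s,t_1,t_1',t_2,t_2'$ on $\mathbb{A}^5_k$. Then $\dim X=3$, and $X$ has at most $t+1$ irreducible components of dimension $3$. -/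

import Mathlib

open MvPolynomial AlgebraicGeometry

universe u

/-- The polynomial `(t₂ - t₂')² f(t₂, t₂') - (t₁ - t₁')² g(t₁, t₁')` in `k[t₁, t₁', t₂, t₂']`.
The variables `t₁, t₁', t₂, t₂'` are `X 0, X 1, X 2, X 3`, in this order. -/
noncomputable def mixedPolynomial {k : Type u} [Field k] (f g : MvPolynomial (Fin 2) k) :
    MvPolynomial (Fin 4) k :=
  (X 2 - X 3) ^ 2 * rename ![2, 3] f - (X 0 - X 1) ^ 2 * rename ![0, 1] g

/-- The first equation `s (t₁ - t₁') + (t₂ - t₂') f(t₂, t₂')` in `k[s, t₁, t₁', t₂, t₂']`.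
The variables `s, t₁, t₁', t₂, t₂'` are `X 0, X 1, X 2, X 3, X 4`, in this order. -/
noncomputable def mixedEquation₁ {k : Type u} [Field k] (f : MvPolynomial (Fin 2) k) :
    MvPolynomial (Fin 5) k :=
  X 0 * (X 1 - X 2) + (X 3 - X 4) * rename ![3, 4] f

/-- The second equation `s (t₂ - t₂') + (t₁ - t₁') g(t₁, t₁')` in `k[s, t₁, t₁', t₂, t₂']`,
with the same order of the variables as in `mixedEquation₁`. -/
noncomputable def mixedEquation₂ {k : Type u} [Field k] (g : MvPolynomial (Fin 2) k) :
    MvPolynomial (Fin 5) k :=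
  X 0 * (X 3 - X 4) + (X 1 - X 2) * rename ![1, 2] g

/-- The closed subscheme `X` of affine 5-space over `k` cut out by the two equations:
the spectrum of `k[s, t₁, t₁', t₂, t₂']` modulo the ideal that they generate. -/
noncomputable def mixedVariety {k : Type u} [Field k] (f g : MvPolynomial (Fin 2) k) :
    Scheme.{u} :=
  Spec (CommRingCat.of
    (MvPolynomial (Fin 5) k ⧸ Ideal.span {mixedEquation₁ f, mixedEquation₂ g}))

/-- The set of irreducible factors of `P`, taken up to associates (so each distinct
factor occurs once, whatever its multiplicity). -/
def irreducibleFactors {R : Type u} [CommRing R] (P : R) : Set (Associates R) :=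
  {p | Irreducible p ∧ p ∣ Associates.mk P}

/-- The irreducible components of a topological space `Y` whose dimension is the dimension
of `Y`. -/
def topDimensionalComponents (Y : Type u) [TopologicalSpace Y] : Set (Set Y) :=
  {Z | Z ∈ irreducibleComponents Y ∧ topologicalKrullDim Z = topologicalKrullDim Y}

/-!
With `T = s`, `a = t₂ - t₂'`, `c = t₁ - t₁'`, `b = c g` and `d = a f`, the variety is cut out by
the two linear equations `a T + b = c T + d = 0` over `k[t₁, t₁', t₂, t₂']`, and `a d - b c` is
the mixed polynomial. Where `a` or `c` is invertible, one equation determines `T` and the other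
then says `a d - b c = 0`. So away from the linear space `a = c = 0`, forgetting `s` identifies
the variety with an open subset of the hypersurface `a d - b c = 0`. Since `b` and `d` lie in the
prime ideal `(a, c)`, the variety contains this linear space; it accounts for at most one
component, and every other component comes from an irreducible factor of the mixed polynomial.

The linear space has dimension three. A common factor of the two equations divides `a d - b c ≠ 0`,
so it is free of `T` and divides both `a` and `c`; hence the equations are coprime, therefore a
regular sequence, and the dimension is at most three.
-/

open scoped Polynomial

section KrullDimension

variable {A : Type*} [CommRing A]

lemma mk_mem_nonZeroDivisors_of_isRelPrime [DecompositionMonoid A] {x y : A}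
    (h : IsRelPrime x y) :
    Ideal.Quotient.mk (Ideal.span {x}) y ∈ nonZeroDivisors (A ⧸ Ideal.span {x}) := by
  refine mem_nonZeroDivisors_iff_right.2 fun z hz ↦ ?_
  obtain ⟨z, rfl⟩ := Ideal.Quotient.mk_surjective z
  rw [← map_mul, Ideal.Quotient.eq_zero_iff_dvd] at hz
  exact (Ideal.Quotient.eq_zero_iff_dvd x z).2 (h.dvd_of_dvd_mul_right hz)

lemma ringKrullDim_quotient_span_pair_add_two_le [DecompositionMonoid A] {x y : A}
    (hx : x ∈ nonZeroDivisors A) (h : IsRelPrime x y) :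
    ringKrullDim (A ⧸ Ideal.span {x, y}) + 2 ≤ ringKrullDim A := by
  have hle : Ideal.span {x} ≤ Ideal.span {x, y} := Ideal.span_mono (by simp)
  calc ringKrullDim (A ⧸ Ideal.span {x, y}) + 2
      = ringKrullDim (A ⧸ Ideal.span {x, y}) + 1 + 1 := by rw [add_assoc, one_add_one_eq_two]
    _ ≤ ringKrullDim (A ⧸ Ideal.span {x}) + 1 := by
      gcongr
      refine ringKrullDim_succ_le_of_surjective (Ideal.Quotient.factor hle)
        (Ideal.Quotient.factor_surjective hle) (mk_mem_nonZeroDivisors_of_isRelPrime h) ?_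
      exact Ideal.Quotient.eq_zero_iff_mem.2 (Ideal.subset_span (by simp))
    _ ≤ ringKrullDim A := ringKrullDim_quotient_succ_le_of_nonZeroDivisor hx

end KrullDimension

section MinimalPrimes

lemma encard_irreducibleComponents_primeSpectrum_quotient {A : Type*} [CommRing A] (I : Ideal A) :
    (irreducibleComponents (PrimeSpectrum (A ⧸ I))).encard = I.minimalPrimes.encard := by
  rw [← Set.encard_congr (minimalPrimes.equivIrreducibleComponents (A ⧸ I)).toEquiv,
    I.minimalPrimes_eq_comap]
  exact ((Ideal.comap_injective_of_surjective _ Ideal.Quotient.mk_surjective).encard_image _).symm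

lemma exists_prime_dvd_of_mem_minimalPrimes_span_singleton {R : Type*} [CommRing R] [IsDomain R]
    [UniqueFactorizationMonoid R] {x : R} (hx : x ≠ 0) {p : Ideal R}
    (hp : p ∈ (Ideal.span {x}).minimalPrimes) : ∃ q, Prime q ∧ q ∣ x ∧ p = Ideal.span {q} := by
  have hxp : x ∈ p := hp.le (Ideal.mem_span_singleton_self x)
  obtain ⟨m, hm, u, rfl⟩ := UniqueFactorizationMonoid.exists_prime_factors x hx
  obtain ⟨q, hqm, hqp⟩ := (hp.isPrime.multiset_prod_mem_iff_exists_mem m).1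
    ((Ideal.mul_unit_mem_iff_mem p u.isUnit).1 hxp)
  have hqx : q ∣ m.prod * u := (Multiset.dvd_prod hqm).mul_right _
  have hle : Ideal.span {q} ≤ p := (Ideal.span_singleton_le_iff_mem p).2 hqp
  refine ⟨q, hm q hqm, hqx, le_antisymm (hp.2 ⟨?_, ?_⟩ hle) hle⟩
  · exact (Ideal.span_singleton_prime (hm q hqm).ne_zero).2 (hm q hqm)
  · exact Ideal.span_singleton_le_span_singleton.2 hqx

lemma encard_minimalPrimes_span_singleton_le {R : Type u} [CommRing R] [IsDomain R]
    [UniqueFactorizationMonoid R] {x : R} (hx : x ≠ 0) :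
    (Ideal.span {x}).minimalPrimes.encard ≤ (irreducibleFactors x).encard := by
  suffices h : (Ideal.span {x}).minimalPrimes ⊆
      (fun q ↦ (Ideal.associatesEquivIsPrincipal R q : Ideal R)) '' irreducibleFactors x from
    (Set.encard_le_encard h).trans (Set.encard_image_le _ _)
  intro p hp
  obtain ⟨q, hq, hqx, rfl⟩ := exists_prime_dvd_of_mem_minimalPrimes_span_singleton hx hp
  exact ⟨Associates.mk q, ⟨Associates.irreducible_mk.2 hq.irreducible, Associates.mk_dvd_mk.2 hqx⟩,
    Ideal.associatesEquivIsPrincipal_apply q⟩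

end MinimalPrimes

section LinearPencil

variable {R : Type*} [CommRing R] {a b c d : R}

/-- The ideal of `R[T]` generated by the two linear polynomials `a T + b` and `c T + d`.
The mixed variety is its zero locus for `T = s` and `R = k[t₁, t₁', t₂, t₂']`. -/
noncomputable def linearPencilIdeal (a b c d : R) : Ideal R[X] :=
  Ideal.span {Polynomial.C a * Polynomial.X + Polynomial.C b,
    Polynomial.C c * Polynomial.X + Polynomial.C d}

lemma linearPencilIdeal_comm (a b c d : R) :
    linearPencilIdeal a b c d = linearPencilIdeal c d a b := by
  rw [linearPencilIdeal, linearPencilIdeal, Set.pair_comm]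

lemma left_mem_linearPencilIdeal (a b c d : R) :
    Polynomial.C a * Polynomial.X + Polynomial.C b ∈ linearPencilIdeal a b c d :=
  Ideal.subset_span (Set.mem_insert _ _)

lemma right_mem_linearPencilIdeal (a b c d : R) :
    Polynomial.C c * Polynomial.X + Polynomial.C d ∈ linearPencilIdeal a b c d :=
  Ideal.subset_span (Set.mem_insert_of_mem _ rfl)

lemma C_det_mem_linearPencilIdeal (a b c d : R) :
    Polynomial.C (a * d - b * c) ∈ linearPencilIdeal a b c d := by
  refine Ideal.mem_span_pair.2 ⟨-Polynomial.C c, Polynomial.C a, ?_⟩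
  simp only [map_sub, map_mul]
  ring

lemma isRelPrime_linear [NoZeroDivisors R] (hac : IsRelPrime a c) (hdet : a * d - b * c ≠ 0) :
    IsRelPrime (Polynomial.C a * Polynomial.X + Polynomial.C b)
      (Polynomial.C c * Polynomial.X + Polynomial.C d) := by
  intro h hab hcd
  have hdvd : h ∣ Polynomial.C (a * d - b * c) :=
    Ideal.mem_span_singleton.1 <| Ideal.span_le.2 (Set.pair_subset
      (Ideal.mem_span_singleton.2 hab) (Ideal.mem_span_singleton.2 hcd))
      (C_det_mem_linearPencilIdeal a b c d)
  obtain ⟨r, rfl⟩ : ∃ r, Polynomial.C r = h := by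
    refine Polynomial.natDegree_eq_zero.1 (Nat.le_zero.1 ?_)
    simpa only [Polynomial.natDegree_C] using
      Polynomial.natDegree_le_of_dvd hdvd (Polynomial.C_ne_zero.2 hdet)
  have hra : r ∣ a := by simpa using (Polynomial.C_dvd_iff_dvd_coeff _ _).1 hab 1
  have hrc : r ∣ c := by simpa using (Polynomial.C_dvd_iff_dvd_coeff _ _).1 hcd 1
  exact (hac hra hrc).map Polynomial.C

lemma exists_C_pow_mul_sub_C_mem_span_linear (a b : R) (h : R[X]) :
    ∃ (n : ℕ) (r : R), Polynomial.C a ^ n * h - Polynomial.C r ∈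
      Ideal.span {Polynomial.C a * Polynomial.X + Polynomial.C b} := by
  induction h using Polynomial.induction_on' with
  | add p q hp hq =>
    obtain ⟨n, r, hr⟩ := hp
    obtain ⟨m, s, hs⟩ := hq
    refine ⟨n + m, a ^ m * r + a ^ n * s, ?_⟩
    convert Ideal.add_mem _ (Ideal.mul_mem_left _ (Polynomial.C a ^ m) hr)
      (Ideal.mul_mem_left _ (Polynomial.C a ^ n) hs) using 1
    simp only [map_add, map_mul, map_pow]
    ring
  | monomial n r =>
    -- Modulo `a T + b`, `a ^ n * T ^ n = (-b) ^ n`.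
    refine ⟨n, (-b) ^ n * r, ?_⟩
    have hdvd := sub_dvd_pow_sub_pow (Polynomial.C a * Polynomial.X) (Polynomial.C (-b)) n
    rw [map_neg, sub_neg_eq_add] at hdvd
    convert Ideal.mul_mem_left _ (Polynomial.C r) (Ideal.mem_span_singleton.2 hdvd) using 1
    simp only [← Polynomial.C_mul_X_pow_eq_monomial, map_mul, map_neg, map_pow]
    ring

lemma le_of_comap_C_le_of_linear_mem {p p' : Ideal R[X]} [p'.IsPrime]
    (hp : Polynomial.C a * Polynomial.X + Polynomial.C b ∈ p)
    (hp' : Polynomial.C a * Polynomial.X + Polynomial.C b ∈ p')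
    (ha : Polynomial.C a ∉ p') (hle : p.comap Polynomial.C ≤ p'.comap Polynomial.C) : p ≤ p' := by
  intro h hh
  obtain ⟨n, r, hr⟩ := exists_C_pow_mul_sub_C_mem_span_linear a b h
  have hrp : Polynomial.C r ∈ p :=
    (Submodule.sub_mem_iff_right _ (Ideal.mul_mem_left _ _ hh)).1
      ((Ideal.span_singleton_le_iff_mem p).2 hp hr)
  have hpow : Polynomial.C a ^ n * h ∈ p' :=
    (Submodule.sub_mem_iff_left p' (hle hrp)).1 ((Ideal.span_singleton_le_iff_mem p').2 hp' hr)
  exact (Ideal.IsPrime.mem_or_mem inferInstance hpow).resolve_left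
    (mt (Ideal.IsPrime.mem_of_pow_mem inferInstance n) ha)

lemma le_of_comap_C_le_of_linearPencilIdeal_le {p p' : Ideal R[X]} [p'.IsPrime]
    (hp : linearPencilIdeal a b c d ≤ p) (hp' : linearPencilIdeal a b c d ≤ p')
    (hac : ¬ Ideal.span {a, c} ≤ p'.comap Polynomial.C)
    (hle : p.comap Polynomial.C ≤ p'.comap Polynomial.C) : p ≤ p' := by
  rw [Ideal.span_le, Set.pair_subset_iff, not_and_or] at hac
  rcases hac with ha | hc
  · exact le_of_comap_C_le_of_linear_mem (hp (left_mem_linearPencilIdeal a b c d))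
      (hp' (left_mem_linearPencilIdeal a b c d)) ha hle
  · exact le_of_comap_C_le_of_linear_mem (hp (right_mem_linearPencilIdeal a b c d))
      (hp' (right_mem_linearPencilIdeal a b c d)) hc hle

lemma exists_isPrime_linearPencilIdeal_le_comap_C_eq {q : Ideal R} [q.IsPrime]
    (hdet : a * d - b * c ∈ q) (hac : ¬ Ideal.span {a, c} ≤ q) :
    ∃ p : Ideal R[X], p.IsPrime ∧ linearPencilIdeal a b c d ≤ p ∧ p.comap Polynomial.C = q := by
  wlog ha : a ∉ q generalizing a b c d
  · rw [linearPencilIdeal_comm]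
    rw [Set.pair_comm] at hac
    refine this (by convert q.neg_mem hdet using 1; ring) hac fun hc ↦ hac ?_
    exact Ideal.span_le.2 (Set.pair_subset hc (not_not.1 ha))
  let ι := algebraMap R q.ResidueField
  have hι (r : R) : ι r = 0 ↔ r ∈ q := q.algebraMap_residueField_eq_zero
  have ha₀ : ι a ≠ 0 := mt (hι a).1 ha
  have hdet₀ : ι a * ι d - ι b * ι c = 0 := by simpa using (hι _).2 hdet
  let φ : R[X] →+* q.ResidueField := Polynomial.eval₂RingHom ι (-ι b / ι a)
  refine ⟨RingHom.ker φ, RingHom.ker_isPrime φ, Ideal.span_le.2 (Set.pair_subset ?_ ?_), ?_⟩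
  · suffices ι a * (-ι b / ι a) + ι b = 0 by simpa [φ]
    field_simp
    ring
  · suffices ι c * (-ι b / ι a) + ι d = 0 by simpa [φ]
    field_simp
    linear_combination hdet₀
  · ext r
    simp [φ, hι]

lemma comap_C_mem_minimalPrimes_span_det {p : Ideal R[X]}
    (hp : p ∈ (linearPencilIdeal a b c d).minimalPrimes)
    (hac : ¬ Ideal.span {a, c} ≤ p.comap Polynomial.C) :
    p.comap Polynomial.C ∈ (Ideal.span {a * d - b * c}).minimalPrimes := by
  have := hp.isPrime
  refine ⟨⟨inferInstance, ?_⟩, fun q ⟨hq, hdet⟩ hqp ↦ ?_⟩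
  · exact (Ideal.span_singleton_le_iff_mem _).2 (hp.le (C_det_mem_linearPencilIdeal a b c d))
  · obtain ⟨p', hp', hle, rfl⟩ := exists_isPrime_linearPencilIdeal_le_comap_C_eq
      ((Ideal.span_singleton_le_iff_mem q).1 hdet) fun h ↦ hac (h.trans hqp)
    exact Ideal.comap_mono
      (hp.2 ⟨hp', hle⟩ (le_of_comap_C_le_of_linearPencilIdeal_le hle hp.le hac hqp))

lemma linearPencilIdeal_le_map_C_span_pair (hb : b ∈ Ideal.span {a, c})
    (hd : d ∈ Ideal.span {a, c}) :
    linearPencilIdeal a b c d ≤ (Ideal.span {a, c}).map Polynomial.C := by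
  refine Ideal.span_le.2 (Set.pair_subset ?_ ?_) <;>
    refine Ideal.add_mem _ (Ideal.mul_mem_right _ _ ?_) (Ideal.mem_map_of_mem _ ‹_›) <;>
    exact Ideal.mem_map_of_mem _ (Ideal.subset_span (by simp))

lemma encard_minimalPrimes_linearPencilIdeal_le (hac : (Ideal.span {a, c}).IsPrime)
    (hb : b ∈ Ideal.span {a, c}) (hd : d ∈ Ideal.span {a, c}) :
    (linearPencilIdeal a b c d).minimalPrimes.encard ≤
      (Ideal.span {a * d - b * c}).minimalPrimes.encard + 1 := by
  let p₀ : Ideal R[X] := (Ideal.span {a, c}).map Polynomial.C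
  have hp₀ : p₀.IsPrime := Ideal.isPrime_map_C_of_isPrime
  have hnot {p} (hp : p ∈ (linearPencilIdeal a b c d).minimalPrimes \ {p₀}) :
      ¬ Ideal.span {a, c} ≤ p.comap Polynomial.C := fun h ↦ by
    have hle : p₀ ≤ p := Ideal.map_le_iff_le_comap.2 h
    exact hp.2 (le_antisymm (hp.1.2 ⟨hp₀, linearPencilIdeal_le_map_C_span_pair hb hd⟩ hle) hle)
  calc (linearPencilIdeal a b c d).minimalPrimes.encard
      ≤ ((linearPencilIdeal a b c d).minimalPrimes \ {p₀}).encard + 1 := by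
        simpa using Set.encard_le_encard_sdiff_add_encard _ {p₀}
    _ ≤ (Ideal.span {a * d - b * c}).minimalPrimes.encard + 1 := by
      gcongr
      refine Set.encard_le_encard_of_injOn (f := Ideal.comap Polynomial.C)
        (fun p hp ↦ comap_C_mem_minimalPrimes_span_det hp.1 (hnot hp)) fun p hp p' hp' h ↦ ?_
      have := hp.1.isPrime
      have := hp'.1.isPrime
      exact le_antisymm
        (le_of_comap_C_le_of_linearPencilIdeal_le hp.1.le hp'.1.le (hnot hp') h.le)
        (le_of_comap_C_le_of_linearPencilIdeal_le hp'.1.le hp.1.le (hnot hp) h.ge)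

end LinearPencil

section RenameKernel

variable {σ R : Type*} [CommRing R]

lemma sub_rename_mem_span_X_sub_X (r : σ → σ) (p : MvPolynomial σ R) :
    p - rename r p ∈ Ideal.span (Set.range fun i ↦ (X i - X (r i) : MvPolynomial σ R)) := by
  set I := Ideal.span (Set.range fun i ↦ (X i - X (r i) : MvPolynomial σ R))
  have h : Ideal.Quotient.mkₐ R I = (Ideal.Quotient.mkₐ R I).comp (rename r) := by
    ext i
    rw [AlgHom.comp_apply, rename_X]
    exact Ideal.Quotient.eq.2 (Ideal.subset_span ⟨i, rfl⟩)
  exact Ideal.Quotient.eq.1 (DFunLike.congr_fun h p)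

lemma ker_rename_eq_span_X_sub_X {r : σ → σ} (hr : ∀ i, r (r i) = r i) :
    RingHom.ker (rename (R := R) r) =
      Ideal.span (Set.range fun i ↦ (X i - X (r i) : MvPolynomial σ R)) := by
  refine le_antisymm (fun p hp ↦ ?_) (Ideal.span_le.2 ?_)
  · simpa only [RingHom.mem_ker.1 hp, sub_zero] using sub_rename_mem_span_X_sub_X r p
  · rintro _ ⟨i, rfl⟩
    simp [hr]

lemma isPrime_span_X_sub_X [IsDomain R] {r : σ → σ} (hr : ∀ i, r (r i) = r i) :
    (Ideal.span (Set.range fun i ↦ (X i - X (r i) : MvPolynomial σ R))).IsPrime := by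
  rw [← ker_rename_eq_span_X_sub_X hr]
  exact RingHom.ker_isPrime _

lemma X_sub_X_dvd_iff [DecidableEq σ] {i j : σ} {p : MvPolynomial σ R} :
    X i - X j ∣ p ↔ rename (Function.update id i j) p = 0 := by
  have hr (l : σ) :
      Function.update id i j (Function.update id i j l) = Function.update id i j l := by
    grind
  rw [← Ideal.mem_span_singleton, ← RingHom.mem_ker, ker_rename_eq_span_X_sub_X hr]
  suffices h : Ideal.span {X i - X j} = Ideal.span (Set.range fun l ↦
      (X l - X (Function.update id i j l) : MvPolynomial σ R)) by rw [h]
  refine le_antisymm (Ideal.span_mono ?_) (Ideal.span_le.2 ?_)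
  · exact Set.singleton_subset_iff.2 ⟨i, by simp⟩
  · rintro _ ⟨l, rfl⟩
    obtain rfl | hl := eq_or_ne l i
    · simp
    · simp [hl]

variable [IsDomain R] {i j l m : σ}

lemma prime_X_sub_X (hij : i ≠ j) : Prime (X i - X j : MvPolynomial σ R) := by
  classical
  refine ⟨sub_ne_zero.2 fun h ↦ hij (X_injective h), fun h ↦ ?_, fun p q h ↦ ?_⟩
  · simpa using X_sub_X_dvd_iff.1 (h.dvd (a := 1))
  · simpa [X_sub_X_dvd_iff] using h

lemma isRelPrime_X_sub_X (hij : i ≠ j) (hlm : l ≠ m) (hli : l ≠ i) (hmi : m ≠ i) :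
    IsRelPrime (X i - X j : MvPolynomial σ R) (X l - X m) := by
  classical
  refine (prime_X_sub_X hij).irreducible.isRelPrime_iff_not_dvd.2 fun h ↦ hlm ?_
  refine X_injective (R := R) ?_
  simpa [X_sub_X_dvd_iff, hli, hmi, sub_eq_zero] using h

lemma isPrime_span_pair_X_sub_X (hli : l ≠ i) (hjl : j ≠ l) (hmi : m ≠ i) :
    (Ideal.span {X i - X j, X l - X m} : Ideal (MvPolynomial σ R)).IsPrime := by
  classical
  let r : σ → σ := Function.update (Function.update id i j) l m
  have hri : r i = j := by simp [r, hli.symm]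
  have hrl : r l = m := by simp [r]
  have hr_self {n : σ} (hni : n ≠ i) (hnl : n ≠ l) : r n = n := by simp [r, hni, hnl]
  convert isPrime_span_X_sub_X (R := R) (r := r) (by grind) using 1
  refine le_antisymm (Ideal.span_mono (Set.pair_subset ⟨i, by simp [hri]⟩ ⟨l, by simp [hrl]⟩))
    (Ideal.span_le.2 ?_)
  rintro _ ⟨n, rfl⟩
  by_cases hni : n = i
  · exact Ideal.subset_span (by simp [hni, hri])
  by_cases hnl : n = l
  · exact Ideal.subset_span (by simp [hnl, hrl])
  · simp [hr_self hni hnl]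

end RenameKernel

lemma finSuccEquiv_rename_succ {R : Type*} [CommSemiring R] {n : ℕ} (p : MvPolynomial (Fin n) R) :
    finSuccEquiv R n (rename Fin.succ p) = Polynomial.C p := by
  have h : (finSuccEquiv R n).toAlgHom.comp (rename Fin.succ) = Polynomial.CAlgHom := by
    ext i
    simp [finSuccEquiv_X_succ]
  exact DFunLike.congr_fun h p

section MixedVariety

variable {k : Type u} [Field k] (f g : MvPolynomial (Fin 2) k)

lemma finSuccEquiv_mixedEquation₁ :
    finSuccEquiv k 4 (mixedEquation₁ f) = Polynomial.C (X 0 - X 1) * Polynomial.X +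
      Polynomial.C ((X 2 - X 3) * rename ![2, 3] f) := by
  have hvars : (![3, 4] : Fin 2 → Fin 5) = Fin.succ ∘ ![2, 3] := by decide
  have h : mixedEquation₁ f = rename Fin.succ (X 0 - X 1) * X 0 +
      rename Fin.succ ((X 2 - X 3) * rename ![2, 3] f) := by
    rw [mixedEquation₁, hvars, ← rename_rename, mul_comm (X 0)]
    simp
  rw [h, map_add, map_mul, finSuccEquiv_rename_succ, finSuccEquiv_rename_succ, finSuccEquiv_X_zero]

lemma finSuccEquiv_mixedEquation₂ :
    finSuccEquiv k 4 (mixedEquation₂ g) = Polynomial.C (X 2 - X 3) * Polynomial.X +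
      Polynomial.C ((X 0 - X 1) * rename ![0, 1] g) := by
  have hvars : (![1, 2] : Fin 2 → Fin 5) = Fin.succ ∘ ![0, 1] := by decide
  have h : mixedEquation₂ g = rename Fin.succ (X 2 - X 3) * X 0 +
      rename Fin.succ ((X 0 - X 1) * rename ![0, 1] g) := by
    rw [mixedEquation₂, hvars, ← rename_rename, mul_comm (X 0)]
    simp
  rw [h, map_add, map_mul, finSuccEquiv_rename_succ, finSuccEquiv_rename_succ, finSuccEquiv_X_zero]

lemma span_mixedEquation_eq_comap_linearPencilIdeal :
    Ideal.span {mixedEquation₁ f, mixedEquation₂ g} =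
      (linearPencilIdeal (X 2 - X 3) ((X 0 - X 1) * rename ![0, 1] g)
        (X 0 - X 1) ((X 2 - X 3) * rename ![2, 3] f)).comap (finSuccEquiv k 4).toRingHom := by
  rw [linearPencilIdeal_comm, linearPencilIdeal, ← finSuccEquiv_mixedEquation₁,
    ← finSuccEquiv_mixedEquation₂]
  have h := Ideal.comap_map_of_bijective (finSuccEquiv k 4).toRingHom (finSuccEquiv k 4).bijective
    (I := Ideal.span {mixedEquation₁ f, mixedEquation₂ g})
  rw [Ideal.map_span, Set.image_pair] at h
  exact h.symm

lemma det_eq_mixedPolynomial :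
    (X 2 - X 3) * ((X 2 - X 3) * rename ![2, 3] f) - (X 0 - X 1) * rename ![0, 1] g * (X 0 - X 1) =
      mixedPolynomial f g := by
  rw [mixedPolynomial]
  ring

lemma mixedEquation₁_ne_zero : mixedEquation₁ f ≠ 0 := by
  intro h
  have h₁ := finSuccEquiv_mixedEquation₁ f
  rw [h, map_zero] at h₁
  have hcoeff := congr_arg (Polynomial.coeff · 1) h₁
  simp only [Polynomial.coeff_zero, Polynomial.coeff_add, Polynomial.coeff_C_mul,
    Polynomial.coeff_X_one, Polynomial.coeff_C_succ, mul_one, add_zero] at hcoeff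
  exact (prime_X_sub_X (by decide)).ne_zero hcoeff.symm

lemma le_ringKrullDim_quotient_span_mixedEquation :
    3 ≤ ringKrullDim
      (MvPolynomial (Fin 5) k ⧸ Ideal.span {mixedEquation₁ f, mixedEquation₂ g}) := by
  let φ : MvPolynomial (Fin 5) k →ₐ[k] MvPolynomial (Fin 3) k := rename ![0, 1, 1, 2, 2]
  have hφ : Function.Surjective φ := rename_surjective _ (by decide)
  have hker : Ideal.span {mixedEquation₁ f, mixedEquation₂ g} ≤ RingHom.ker φ :=
    Ideal.span_le.2 (Set.pair_subset (by simp [φ, mixedEquation₁]) (by simp [φ, mixedEquation₂]))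
  calc (3 : WithBot ℕ∞) = ringKrullDim (MvPolynomial (Fin 3) k) := by
        simp [MvPolynomial.ringKrullDim_of_isNoetherianRing]
    _ ≤ _ := ringKrullDim_le_of_surjective (Ideal.Quotient.lift _ φ.toRingHom hker)
        (Ideal.Quotient.lift_surjective_of_surjective _ hker hφ)

variable {f g}

lemma mixedPolynomial_ne_zero (hfg : ¬ (f = 0 ∧ g = 0)) : mixedPolynomial f g ≠ 0 := by
  intro h
  -- Setting `t₁ = t₁'` isolates `f`; setting `t₂ = t₂'` isolates `g`.
  have hf : rename (![1, 1, 2, 3] : Fin 4 → Fin 4) (mixedPolynomial f g) =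
      (X 2 - X 3) ^ 2 * rename ![2, 3] f := by
    have hvars : (![1, 1, 2, 3] : Fin 4 → Fin 4) ∘ ![2, 3] = ![2, 3] := by decide
    simp [mixedPolynomial, rename_rename, hvars]
  have hg : rename (![0, 1, 3, 3] : Fin 4 → Fin 4) (mixedPolynomial f g) =
      -((X 0 - X 1) ^ 2 * rename ![0, 1] g) := by
    have hvars : (![0, 1, 3, 3] : Fin 4 → Fin 4) ∘ ![0, 1] = ![0, 1] := by decide
    simp [mixedPolynomial, rename_rename, hvars]
  rw [h, map_zero, zero_eq_mul, or_iff_right (pow_ne_zero 2 (prime_X_sub_X (by decide)).ne_zero),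
    map_eq_zero_iff _ (rename_injective _ (by decide))] at hf
  rw [h, map_zero, zero_eq_neg, mul_eq_zero,
    or_iff_right (pow_ne_zero 2 (prime_X_sub_X (by decide)).ne_zero),
    map_eq_zero_iff _ (rename_injective _ (by decide))] at hg
  exact hfg ⟨hf, hg⟩

lemma isRelPrime_mixedEquation (hfg : ¬ (f = 0 ∧ g = 0)) :
    IsRelPrime (mixedEquation₁ f) (mixedEquation₂ g) := by
  have hdet := mixedPolynomial_ne_zero hfg
  rw [← det_eq_mixedPolynomial] at hdet
  have hcoprime := isRelPrime_linear
    (isRelPrime_X_sub_X (by decide) (by decide) (by decide) (by decide)) hdet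
  rw [← finSuccEquiv_mixedEquation₁, ← finSuccEquiv_mixedEquation₂] at hcoprime
  exact fun h hf hg ↦ (isUnit_map_iff (finSuccEquiv k 4) h).1
    (hcoprime (map_dvd _ hg) (map_dvd _ hf))

lemma ringKrullDim_quotient_span_mixedEquation_le (hfg : ¬ (f = 0 ∧ g = 0)) :
    ringKrullDim
      (MvPolynomial (Fin 5) k ⧸ Ideal.span {mixedEquation₁ f, mixedEquation₂ g}) ≤ 3 := by
  have h := ringKrullDim_quotient_span_pair_add_two_le
    (mem_nonZeroDivisors_of_ne_zero (mixedEquation₁_ne_zero f)) (isRelPrime_mixedEquation hfg)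
  rw [MvPolynomial.ringKrullDim_of_isNoetherianRing, ringKrullDim_eq_zero_of_field] at h
  have hfive : (0 : WithBot ℕ∞) + (5 : ℕ) = 3 + (2 : ℕ) := by norm_num
  rw [Nat.card_fin, hfive] at h
  exact ENat.WithBot.add_le_add_natCast_right_iff.1 h

lemma encard_minimalPrimes_span_mixedEquation_le (hfg : ¬ (f = 0 ∧ g = 0)) :
    (Ideal.span {mixedEquation₁ f, mixedEquation₂ g}).minimalPrimes.encard ≤
      (irreducibleFactors (mixedPolynomial f g)).encard + 1 := by
  have hprime : (Ideal.span {X 2 - X 3, X 0 - X 1} : Ideal (MvPolynomial (Fin 4) k)).IsPrime :=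
    isPrime_span_pair_X_sub_X (by decide) (by decide) (by decide)
  have hpencil := encard_minimalPrimes_linearPencilIdeal_le hprime
    (Ideal.mul_mem_right (rename ![0, 1] g) _ (Ideal.subset_span (Set.mem_insert_of_mem _ rfl)))
    (Ideal.mul_mem_right (rename ![2, 3] f) _ (Ideal.subset_span (Set.mem_insert _ _)))
  rw [det_eq_mixedPolynomial] at hpencil
  calc (Ideal.span {mixedEquation₁ f, mixedEquation₂ g}).minimalPrimes.encard
      ≤ (linearPencilIdeal (X 2 - X 3) ((X 0 - X 1) * rename ![0, 1] g)
        (X 0 - X 1) ((X 2 - X 3) * rename ![2, 3] f)).minimalPrimes.encard := by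
        rw [span_mixedEquation_eq_comap_linearPencilIdeal]
        exact (Set.encard_le_encard (Ideal.minimalPrimes_comap_subset _ _)).trans
          (Set.encard_image_le _ _)
    _ ≤ (Ideal.span {mixedPolynomial f g}).minimalPrimes.encard + 1 := hpencil
    _ ≤ (irreducibleFactors (mixedPolynomial f g)).encard + 1 := by
        gcongr
        exact encard_minimalPrimes_span_singleton_le (mixedPolynomial_ne_zero hfg)

end MixedVariety

theorem mainTheorem8_general {k : Type u} [Field k] (f g : MvPolynomial (Fin 2) k)
    (hfg : ¬ (f = 0 ∧ g = 0)) :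
    topologicalKrullDim (mixedVariety f g) = 3 ∧
      (irreducibleComponents (mixedVariety f g)).encard ≤
        (irreducibleFactors (mixedPolynomial f g)).encard + 1 := by
  let I := Ideal.span {mixedEquation₁ f, mixedEquation₂ g}
  change topologicalKrullDim (PrimeSpectrum (MvPolynomial (Fin 5) k ⧸ I)) = 3 ∧
    (irreducibleComponents (PrimeSpectrum (MvPolynomial (Fin 5) k ⧸ I))).encard ≤ _
  rw [PrimeSpectrum.topologicalKrullDim_eq_ringKrullDim,
    encard_irreducibleComponents_primeSpectrum_quotient]
  exact ⟨le_antisymm (ringKrullDim_quotient_span_mixedEquation_le hfg)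
    (le_ringKrullDim_quotient_span_mixedEquation f g),
    encard_minimalPrimes_span_mixedEquation_le hfg⟩

theorem mainTheorem8 {k : Type u} [Field k] [IsAlgClosed k] (f g : MvPolynomial (Fin 2) k)
    (hfg : ¬ (f = 0 ∧ g = 0)) (t : ℕ)
    (ht : (irreducibleFactors (mixedPolynomial f g)).encard ≤ (t : ℕ∞)) :
    topologicalKrullDim (mixedVariety f g) = 3 ∧
      (topDimensionalComponents (mixedVariety f g)).encard ≤ (t : ℕ∞) + 1 := by
  obtain ⟨hdim, hcomp⟩ := mainTheorem8_general f g hfg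
  exact ⟨hdim, (Set.encard_le_encard fun Z hZ ↦ hZ.1).trans (hcomp.trans (by gcongr))⟩
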